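/- **Setting.** There are $n$ jobs $J_1,\dots,J_n$ and one machine; job $J_i$ has an integer release time $r_i\ge 0$ and an integer processing time $p_i\ge 1$, and is regarded as a chain of $p_i$ unit tasks. A schedule assigns to each time slot $[t,t+1]$, $t\in\mathbb N=\{0,1,2,\dots\}$, at most one task (preemption is allowed); a job is processed only after its release, the tasks of a job are executed in the order of the chain, and every job is eventually completed. Let $c_i(\mathcal S)$ be the completion time of $J_i$ under $\mathcal S$ and $F(\mathcal S)=\sum_{i=1}^n (c_i(\mathcal S)-r_i)^2$, and let $\mathcal{OPT}$ be a schedule minimizing $F$. A job is active at time $t$ if it is released by time $t$ but not completed by time $t$. Let $\mathcal{SRPT}$ be a schedule that, in every slot with an active job, processes an active job with the fewest remaining tasks (ties broken arbitrarily). **The algorithm $BAL(\theta)$.** Fix $\theta>0$, and let $q_t(i)$ be the number of remaining tasks of $J_i$ at time $t$ under $BAL(\theta)$. An active job $J_i$ becomes starving at the first time $t=t_i\in\mathbb N$ at which $\frac{t-r_i}{q_t(i)}\ge\theta$, and then stays starving until it is completed. In each slot $[t,t+1]$: if there are starving jobs, $BAL(\theta)$ processes the one with the smallest $t_i$ (ties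 are broken in favour of the largest $\frac{t_i-r_i}{q_{t_i}(i)}$, then of the smallest index); otherwise, among the tasks that $\mathcal{SRPT}$ executes in the slots starting at $0,\dots,t$ and that $BAL(\theta)$ has not yet executed, it executes the one that is completed earliest under $\mathcal{SRPT}$ (and idles if there is none). Let $\mathcal{BAL}(\theta)$ be the resulting schedule. If $J_i$ becomes starving at time $t_i$, put $starv_i(\theta)=c_i(\mathcal{BAL}(\theta))-t_i$; if $J_i$ never becomes starving, put $starv_i(\theta)=0$. **Theorem.** There is an absolute constant $C>0$ such that for every instance with any number $n$ of jobs, every $\theta>0$, every choice of $\mathcal{SRPT}$ and every optimal schedule $\mathcal{OPT}$, the schedule $\mathcal{BAL}(\theta)$ is a valid schedule (in particular it completes every job) and $$\sum_{i=1}^n starv_i(\theta)^2\;\le\; C\,\frac{n}{\sqrt\theta}\;F(\mathcal{OPT}).$$ -/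

import Mathlib

open Finset

/-- `n` jobs for a single machine, with integral release times and positive integral processing
times. Job `i` is a chain of `proc i` unit tasks. -/
structure JobInstance (n : ℕ) where
  release : Fin n → ℕ
  proc : Fin n → ℕ
  proc_pos : ∀ i, 0 < proc i

/-- A (preemptive) schedule says which job, if any, is processed in each time slot `[t, t+1]`.
The tasks of a job are executed in the order of its chain, so naming the job names the task. -/
abbrev Schedule (n : ℕ) := ℕ → Option (Fin n)

namespace Schedule

variable {n : ℕ}

/-- The number of tasks of job `i` that have been executed by time `t`. -/
def executed (S : Schedule n) (t : ℕ) (i : Fin n) : ℕ := #{s ∈ range t | S s = some i}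

/-- The task executed in slot `t`: the pair `(i, k)` stands for the task of job `i` that has
exactly `k` predecessors in its chain. -/
def taskAt (S : Schedule n) (t : ℕ) : Option (Fin n × ℕ) :=
  (S t).map fun i => (i, S.executed t i)

/-- The set of the tasks that are executed before time `t`, i.e. in the slots `0, …, t - 1`. -/
def tasksBefore (S : Schedule n) (t : ℕ) : Set (Fin n × ℕ) :=
  {a | ∃ s < t, S.taskAt s = some a}

/-- The completion time of a task: `t + 1` if it is executed in slot `t`. -/
noncomputable def taskCompletion (S : Schedule n) (a : Fin n × ℕ) : ℕ :=
  sInf {c | ∃ t, S.taskAt t = some a ∧ c = t + 1}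

end Schedule

namespace JobInstance

variable {n : ℕ}

/-- Job `i` is active at time `t`: released by time `t` but not completed by time `t`. -/
def Active (I : JobInstance n) (S : Schedule n) (t : ℕ) (i : Fin n) : Prop :=
  I.release i ≤ t ∧ S.executed t i < I.proc i

open Classical in
/-- The number of remaining tasks of job `i` at time `t` if the job is active, and `0` if not. -/
noncomputable def remaining (I : JobInstance n) (S : Schedule n) (t : ℕ) (i : Fin n) : ℕ :=
  if I.Active S t i then I.proc i - S.executed t i else 0

/-- Only active jobs are processed, and every job is eventually completed. -/
def Feasible (I : JobInstance n) (S : Schedule n) : Prop :=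
  (∀ t i, S t = some i → I.Active S t i) ∧ ∀ i, ∃ t, S.executed t i = I.proc i

/-- The completion time of job `i`: the first time by which all its tasks have been executed. -/
noncomputable def completion (I : JobInstance n) (S : Schedule n) (i : Fin n) : ℕ :=
  sInf {t | S.executed t i = I.proc i}

/-- The flow time of job `i`. -/
noncomputable def flow (I : JobInstance n) (S : Schedule n) (i : Fin n) : ℝ :=
  (I.completion S i : ℝ) - (I.release i : ℝ)

/-- The objective `F`: the sum of the squared flow times. -/
noncomputable def F (I : JobInstance n) (S : Schedule n) : ℝ := ∑ i, I.flow S i ^ 2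

/-- `S` is an optimal schedule: feasible, with the least sum of squared flow times (equivalently,
the least `ℓ₂` norm of the flow times). -/
def IsOptimal (I : JobInstance n) (S : Schedule n) : Prop :=
  I.Feasible S ∧ ∀ S' : Schedule n, I.Feasible S' → I.F S ≤ I.F S'

/-- `S` is a schedule produced by Shortest Remaining Processing Time, with arbitrary tie-breaking:
whenever there are active jobs, one with the fewest remaining tasks is processed. -/
def IsSRPT (I : JobInstance n) (S : Schedule n) : Prop :=
  ∀ t, (∀ i, S t = some i →
      I.Active S t i ∧ ∀ j, I.Active S t j → I.remaining S t i ≤ I.remaining S t j) ∧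
    (S t = none → ∀ i, ¬ I.Active S t i)

/-- The starvation condition at time `t`: job `i` is active and `(t - r_i) / q_t(i) ≥ θ`. -/
def Starving (I : JobInstance n) (θ : ℝ) (S : Schedule n) (t : ℕ) (i : Fin n) : Prop :=
  I.Active S t i ∧ θ ≤ ((t : ℝ) - (I.release i : ℝ)) / (I.remaining S t i : ℝ)

/-- The time at which job `i` becomes starving (meaningful if it ever does). -/
noncomputable def starvingTime (I : JobInstance n) (θ : ℝ) (S : Schedule n) (i : Fin n) : ℕ :=
  sInf {t | I.Starving θ S t i}

/-- The ratio `γ_i`, i.e. `(t - r_i) / q_t(i)` at the time `t` at which `i` becomes starving. -/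
noncomputable def starvingRatio (I : JobInstance n) (θ : ℝ) (S : Schedule n) (i : Fin n) : ℝ :=
  ((I.starvingTime θ S i : ℝ) - (I.release i : ℝ)) /
    (I.remaining S (I.starvingTime θ S i) i : ℝ)

open Classical in
/-- The set `ST` at time `t`: the jobs that have become starving by time `t` and are not yet
completed. -/
noncomputable def starvingSet (I : JobInstance n) (θ : ℝ) (S : Schedule n) (t : ℕ) :
    Finset (Fin n) :=
  {i | I.Active S t i ∧ ∃ s ≤ t, I.Starving θ S s i}

/-- The priority of starving jobs (smaller goes first): earliest starving time, then largest
ratio `γ_i`, then smallest index. -/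
noncomputable def starvingKey (I : JobInstance n) (θ : ℝ) (S : Schedule n) (i : Fin n) :
    ℕ ×ₗ (ℝᵒᵈ ×ₗ Fin n) :=
  toLex (I.starvingTime θ S i, toLex (OrderDual.toDual (I.starvingRatio θ S i), i))

/-- The tasks that the reference schedule `σ` executes in the slots `0, …, t` and that `S` has not
executed in the slots `0, …, t - 1`. -/
def backlog (σ S : Schedule n) (t : ℕ) : Set (Fin n × ℕ) :=
  σ.tasksBefore (t + 1) \ S.tasksBefore t

open Classical in
/-- The decision of `BAL(θ)` for slot `t`, given its own schedule `S` in the slots before `t` and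
the SRPT schedule `σ` that it follows while no job is starving. -/
noncomputable def balChoice (I : JobInstance n) (θ : ℝ) (σ S : Schedule n) (t : ℕ) :
    Option (Fin n) :=
  if h : (I.starvingSet θ S t).Nonempty then
    some (Classical.choose ((I.starvingSet θ S t).exists_min_image (I.starvingKey θ S) h))
  else if h' : (backlog σ S t).Nonempty then
    some (Function.argminOn σ.taskCompletion (backlog σ S t) h').1
  else none

/-- The schedule of `BAL(θ)`, built slot by slot; when slot `t` is decided, the slots before `t`
are known and the others are blank. -/
noncomputable def bal (I : JobInstance n) (θ : ℝ) (σ : Schedule n) (t : ℕ) : Option (Fin n) :=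
  I.balChoice θ σ (fun s => if s < t then I.bal θ σ s else none) t
termination_by t

open Classical in
/-- The time `t_i` at which the normal period of job `i` ends under `S`: the time at which it
becomes starving, or its completion time if it never becomes starving. -/
noncomputable def normalEnd (I : JobInstance n) (θ : ℝ) (S : Schedule n) (i : Fin n) : ℕ :=
  if ∃ t, I.Starving θ S t i then I.starvingTime θ S i else I.completion S i

/-- `starv_i(θ)`: the length of the starving period of job `i` under `BAL(θ)`. -/
noncomputable def starv (I : JobInstance n) (θ : ℝ) (σ : Schedule n) (i : Fin n) : ℝ :=
  (I.completion (I.bal θ σ) i : ℝ) - (I.normalEnd θ (I.bal θ σ) i : ℝ)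

end JobInstance

/-! Every single job satisfies `√θ * starv² ≤ 4 * F A` for any feasible `A`
(`sqrt_mul_starv_sq_le`); summing over the jobs gives the factor `n`. Call late the tasks a job
still has when it becomes starving. While job `i` starves, BAL executes only late tasks of jobs that
became starving no later than `i`, so its starving period is at most the volume of such tasks
pending at `t_i` (`completion_sub_starvingTime_le`). By any time BAL has executed at least as many
tasks as SRPT, and its non-late ones were executed by SRPT too, so SRPT has at least as much late
volume pending (`sum_sub_max_le`). If `z_j` late tasks of job `j` are pending, the job has age at
least `θ z_j`. Let `Z` be the sum of the `z_j` (`IsSRPT.sqrt_mul_sq_le`). Either some `⌊√θ⌋` jobs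
hold half of `Z`, and Cauchy–Schwarz makes the age-weighted volume, a lower bound for `F A`, large.
Or half of `Z` lies outside any `⌊√θ⌋` jobs; SRPT minimizes such outside work
(`IsSRPT.exists_sum_remaining_le`), so more than `√θ` jobs wait at least `Z/2` under `A`. -/

namespace Schedule

variable {n : ℕ}

/-! ### Counting executed tasks. -/

theorem executed_zero (S : Schedule n) (i : Fin n) : S.executed 0 i = 0 := by
  simp [executed]

theorem executed_succ (S : Schedule n) (t : ℕ) (i : Fin n) :
    S.executed (t + 1) i = S.executed t i + if S t = some i then 1 else 0 := by
  unfold executed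
  rw [range_add_one, filter_insert]
  split_ifs with h
  · rw [card_insert_of_notMem (by simp)]
  · rfl

theorem executed_mono (S : Schedule n) (i : Fin n) : Monotone fun t => S.executed t i :=
  monotone_nat_of_le_succ fun t => by rw [executed_succ]; omega

theorem executed_congr {S S' : Schedule n} {t : ℕ} (h : ∀ s < t, S s = S' s) (i : Fin n) :
    S.executed t i = S'.executed t i := by
  unfold executed
  congr 1
  apply filter_congr
  intro s hs
  rw [h s (mem_range.1 hs)]

theorem mem_tasksBefore (S : Schedule n) (t : ℕ) (i : Fin n) (k : ℕ) :
    (i, k) ∈ S.tasksBefore t ↔ k < S.executed t i := by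
  have aux : ∀ s, S.taskAt s = some (i, k) ↔ S s = some i ∧ S.executed s i = k := by
    intro s
    simp only [taskAt, Option.map_eq_some_iff, Prod.mk.injEq]
    constructor
    · rintro ⟨a, h, rfl, h'⟩
      exact ⟨h, h'⟩
    · rintro ⟨h, h'⟩
      exact ⟨i, h, rfl, h'⟩
  simp only [tasksBefore, Set.mem_ofPred_eq, aux]
  induction t with
  | zero => simp [executed_zero]
  | succ t ih =>
    rw [executed_succ]
    constructor
    · rintro ⟨s, hs, h, h'⟩
      rcases Nat.lt_succ_iff_lt_or_eq.1 hs with hs | rfl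
      · have := ih.1 ⟨s, hs, h, h'⟩
        omega
      · simp [h, h']
    · intro h
      by_cases hk : k < S.executed t i
      · obtain ⟨s, hs, h⟩ := ih.2 hk
        exact ⟨s, by omega, h⟩
      · split_ifs at h with hi
        · exact ⟨t, by omega, hi, by omega⟩
        · omega

theorem sum_indicator_le_one (S : Schedule n) (t : ℕ) (T : Finset (Fin n)) :
    (∑ i ∈ T, if S t = some i then 1 else 0) ≤ 1 := by
  rcases h : S t with _ | j
  · simp
  · simp only [Option.some.injEq, sum_ite_eq]
    split_ifs <;> simp

theorem sum_indicator_eq_one {S : Schedule n} {t : ℕ} {T : Finset (Fin n)} {j : Fin n}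
    (h : S t = some j) (hj : j ∈ T) : (∑ i ∈ T, if S t = some i then 1 else 0) = 1 := by
  simp [h, hj]

theorem sum_executed_add_le (S : Schedule n) (T : Finset (Fin n)) (t d : ℕ) :
    ∑ i ∈ T, S.executed (t + d) i ≤ ∑ i ∈ T, S.executed t i + d := by
  induction d with
  | zero => simp
  | succ d ih =>
    have := S.sum_indicator_le_one (t + d) T
    rw [← add_assoc]
    simp only [executed_succ, sum_add_distrib]
    omega

end Schedule

namespace JobInstance

variable {n : ℕ} {I : JobInstance n} {θ : ℝ} {S A σ : Schedule n}

/-! ### Remaining work, slot by slot. -/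

/-- Only active jobs are processed. -/
def Valid (I : JobInstance n) (S : Schedule n) : Prop :=
  ∀ t i, S t = some i → I.Active S t i

theorem Feasible.valid (h : I.Feasible S) : I.Valid S := h.1

theorem IsSRPT.valid (h : I.IsSRPT S) : I.Valid S := fun t i hi => ((h t).1 i hi).1

theorem Valid.executed_le (h : I.Valid S) (t : ℕ) (i : Fin n) : S.executed t i ≤ I.proc i := by
  induction t with
  | zero => simp [Schedule.executed_zero]
  | succ t ih =>
    rw [Schedule.executed_succ]
    split_ifs with hi
    · have := (h t i hi).2
      omega
    · exact ih

theorem Valid.executed_eq_zero (h : I.Valid S) {t : ℕ} {i : Fin n} (ht : t ≤ I.release i) :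
    S.executed t i = 0 := by
  induction t with
  | zero => simp [Schedule.executed_zero]
  | succ t ih =>
    rw [Schedule.executed_succ, ih (by omega), if_neg]
    intro hi
    have := (h t i hi).1
    omega

theorem remaining_eq (I : JobInstance n) (S : Schedule n) (t : ℕ) (i : Fin n) :
    I.remaining S t i = if I.release i ≤ t then I.proc i - S.executed t i else 0 := by
  unfold remaining Active
  split_ifs <;> omega

/-- The number of tasks of job `i` remaining after slot `t`, before the arrivals at `t + 1`. -/
def remainingAfter (I : JobInstance n) (S : Schedule n) (t : ℕ) (i : Fin n) : ℕ :=
  if I.release i ≤ t then I.proc i - S.executed (t + 1) i else 0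

theorem Valid.remaining_eq_after (h : I.Valid S) (t : ℕ) (i : Fin n) :
    I.remaining S t i = I.remainingAfter S t i + if S t = some i then 1 else 0 := by
  rw [remaining_eq, remainingAfter, Schedule.executed_succ]
  by_cases hi : S t = some i
  · obtain ⟨h1, h2⟩ := h t i hi
    simp only [h1, hi, if_true]
    omega
  · simp [hi]

theorem Valid.remaining_succ (h : I.Valid S) (t : ℕ) (i : Fin n) :
    I.remaining S (t + 1) i =
      I.remainingAfter S t i + if I.release i = t + 1 then I.proc i else 0 := by
  rw [remaining_eq, remainingAfter]
  by_cases hi : I.release i = t + 1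
  · rw [h.executed_eq_zero hi.ge]
    simp [hi]
  · have : I.release i ≤ t + 1 ↔ I.release i ≤ t := by omega
    simp [hi, this]

theorem Valid.sum_remaining_le_after (h : I.Valid S) (t : ℕ) (T : Finset (Fin n)) :
    ∑ i ∈ T, I.remaining S t i ≤ ∑ i ∈ T, I.remainingAfter S t i + 1 := by
  simp only [h.remaining_eq_after, sum_add_distrib]
  exact Nat.add_le_add_left (S.sum_indicator_le_one t T) _

theorem Valid.sum_remaining_eq_after (h : I.Valid S) {t : ℕ} {T : Finset (Fin n)} {j : Fin n}
    (hj : S t = some j) (hT : j ∈ T) :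
    ∑ i ∈ T, I.remaining S t i = ∑ i ∈ T, I.remainingAfter S t i + 1 := by
  simp only [h.remaining_eq_after, sum_add_distrib]
  rw [Schedule.sum_indicator_eq_one hj hT]

theorem active_of_remaining_ne_zero {t : ℕ} {i : Fin n} (h : I.remaining S t i ≠ 0) :
    I.Active S t i := by
  unfold remaining at h
  split_ifs at h with h'
  · exact h'
  · exact absurd rfl h

/-! ### Optimality of SRPT for remaining work. -/

/-- A slot lowers the right side by at most one. If SRPT works outside `K'`, its side also drops by
one. If it works on `j ∈ K'`, exchange `j` for an unfinished `l ∉ K'`: the outside work does not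
grow, as `j` has the fewest remaining tasks, and now the slot counts. -/
theorem IsSRPT.exists_sum_remainingAfter_le (hS : I.IsSRPT S) (hA : I.Valid A) {t : ℕ}
    (ih : ∀ K : Finset (Fin n), ∃ K' : Finset (Fin n), #K' ≤ #K ∧
      ∑ i ∈ K'ᶜ, I.remaining S t i ≤ ∑ i ∈ Kᶜ, I.remaining A t i) (K : Finset (Fin n)) :
    ∃ K' : Finset (Fin n), #K' ≤ #K ∧
      ∑ i ∈ K'ᶜ, I.remainingAfter S t i ≤ ∑ i ∈ Kᶜ, I.remainingAfter A t i := by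
  obtain ⟨K', hK', hsum⟩ := ih K
  have hA1 := hA.sum_remaining_le_after t Kᶜ
  by_cases h0 : ∀ l ∉ K', I.remaining S t l = 0
  · refine ⟨K', hK', ?_⟩
    rw [sum_eq_zero]
    · exact Nat.zero_le _
    · intro l hl
      have := h0 l (mem_compl.1 hl)
      rw [hS.valid.remaining_eq_after] at this
      omega
  push Not at h0
  obtain ⟨l, hl, hl0⟩ := h0
  have hact := active_of_remaining_ne_zero hl0
  rcases hj : S t with _ | j
  · exact absurd hact ((hS t).2 hj l)
  by_cases hjK : j ∈ K'
  · have hle := ((hS t).1 j hj).2 l hact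
    have hlj : l ≠ j := fun h => hl (h ▸ hjK)
    refine ⟨insert l (K'.erase j), ?_, ?_⟩
    · rw [card_insert_of_notMem (by simp [hl]), card_erase_of_mem hjK]
      have := card_pos.2 ⟨j, hjK⟩
      omega
    · have hmem : j ∈ (insert l (K'.erase j))ᶜ := by simp [hlj.symm]
      have h1 := hS.valid.sum_remaining_eq_after hj hmem
      have h2 : (insert l (K'.erase j))ᶜ = insert j (K'ᶜ.erase l) := by
        ext x
        simp only [mem_compl, mem_insert, mem_erase]
        by_cases hx : x = j
        · subst hx; simp [hlj.symm]
        · simp [hx]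
      have h3 : ∑ i ∈ insert j (K'ᶜ.erase l), I.remaining S t i
          = I.remaining S t j + ∑ i ∈ K'ᶜ.erase l, I.remaining S t i :=
        sum_insert (by simp [hjK])
      have h4 := add_sum_erase K'ᶜ (I.remaining S t) (mem_compl.2 hl)
      rw [← h2] at h3
      omega
  · refine ⟨K', hK', ?_⟩
    have := hS.valid.sum_remaining_eq_after hj (mem_compl.2 hjK)
    omega

/-- SRPT minimizes, for every `k`, the remaining work outside the `k` longest jobs. -/
theorem IsSRPT.exists_sum_remaining_le (hS : I.IsSRPT S) (hA : I.Valid A) (t : ℕ)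
    (K : Finset (Fin n)) : ∃ K' : Finset (Fin n), #K' ≤ #K ∧
      ∑ i ∈ K'ᶜ, I.remaining S t i ≤ ∑ i ∈ Kᶜ, I.remaining A t i := by
  induction t generalizing K with
  | zero => exact ⟨K, le_rfl, by simp [remaining_eq, Schedule.executed_zero]⟩
  | succ t ih =>
    let N : Finset (Fin n) := {i | I.release i = t + 1}
    -- Arrivals have full size under both schedules, so those in `K` can simply be added to `K'`.
    obtain ⟨K', hK', hsum⟩ := hS.exists_sum_remainingAfter_le hA ih (K \ N)
    refine ⟨K' ∪ (K ∩ N), ?_, ?_⟩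
    · have := card_union_le K' (K ∩ N)
      have := card_sdiff_add_card_inter K N
      omega
    · have key : ∀ (T : Finset (Fin n)) (f : Fin n → ℕ),
          ∑ i ∈ Tᶜ, f i = ∑ i, if i ∈ T then 0 else f i := by
        intro T f
        simp_rw [← ite_not (_ ∈ T)]
        rw [← sum_filter, compl_eq_univ_sdiff, filter_notMem_eq_sdiff]
      simp only [key] at hsum ⊢
      calc _ ≤ ∑ i, ((if i ∈ K' then 0 else I.remainingAfter S t i)
              + if i ∈ N ∧ i ∉ K then I.proc i else 0) := by
            refine sum_le_sum fun i _ => ?_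
            rw [hS.valid.remaining_succ]
            simp only [N, mem_union, mem_inter, mem_filter, mem_univ, true_and]
            by_cases h1 : I.release i = t + 1 <;> by_cases h2 : i ∈ K <;>
              by_cases h3 : i ∈ K' <;> simp [h1, h2, h3]
        _ ≤ ∑ i, ((if i ∈ K \ N then 0 else I.remainingAfter A t i)
              + if i ∈ N ∧ i ∉ K then I.proc i else 0) := by
            rw [sum_add_distrib, sum_add_distrib]
            omega
        _ ≤ _ := by
            refine sum_le_sum fun i _ => ?_
            rw [hA.remaining_succ]
            simp only [N, mem_sdiff, mem_filter, mem_univ, true_and]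
            by_cases h1 : I.release i = t + 1 <;> by_cases h2 : i ∈ K <;>
              simp [h1, h2, remainingAfter]

theorem IsSRPT.sum_remaining_le (hS : I.IsSRPT S) (hA : I.Valid A) (t : ℕ) :
    ∑ i, I.remaining S t i ≤ ∑ i, I.remaining A t i := by
  obtain ⟨K', hK', h⟩ := hS.exists_sum_remaining_le hA t ∅
  rw [card_empty, Nat.le_zero, card_eq_zero] at hK'
  simpa [hK'] using h

/-! ### Lower bounds on the objective. -/

theorem Feasible.executed_completion (hA : I.Feasible A) (i : Fin n) :
    A.executed (I.completion A i) i = I.proc i :=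
  Nat.sInf_mem (s := {t | A.executed t i = I.proc i}) (hA.2 i)

theorem Feasible.executed_of_completion_le (hA : I.Feasible A) {i : Fin n} {t : ℕ}
    (h : I.completion A i ≤ t) : A.executed t i = I.proc i :=
  le_antisymm (hA.valid.executed_le t i) (hA.executed_completion i ▸ A.executed_mono i h)

theorem Feasible.release_le_completion (hA : I.Feasible A) (i : Fin n) :
    I.release i ≤ I.completion A i := by
  by_contra! h
  have := hA.valid.executed_eq_zero h.le
  have := hA.executed_completion i
  have := I.proc_pos i
  omega

theorem Feasible.sum_remaining_le (hA : I.Feasible A) (T : Finset (Fin n)) (t d : ℕ)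
    (h : ∀ i ∈ T, I.release i ≤ t → I.completion A i ≤ t + d) :
    ∑ i ∈ T, I.remaining A t i ≤ d := by
  have h1 := A.sum_executed_add_le {i ∈ T | I.release i ≤ t} t d
  have h2 : ∑ i ∈ T, I.remaining A t i + ∑ i ∈ T with I.release i ≤ t, A.executed t i
      = ∑ i ∈ T with I.release i ≤ t, A.executed (t + d) i := by
    simp only [remaining_eq]
    rw [← sum_filter, ← sum_add_distrib]
    refine sum_congr rfl fun i hi => ?_
    obtain ⟨hi, hr⟩ := mem_filter.1 hi
    rw [hA.executed_of_completion_le (h i hi hr)]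
    have := hA.valid.executed_le t i
    omega
  omega

/-- The sum of the squared flow times, as a natural number. -/
noncomputable def sqFlow (I : JobInstance n) (S : Schedule n) : ℕ :=
  ∑ i, (I.completion S i - I.release i) ^ 2

theorem Feasible.F_eq (hA : I.Feasible A) : I.F A = I.sqFlow A := by
  unfold F flow sqFlow
  push_cast
  refine sum_congr rfl fun i _ => ?_
  rw [Nat.cast_sub (hA.release_le_completion i)]

/-- The work present at `u` is at most the longest residual wait, hence at most the sum of all
residual waits. Each wait is at most the flow time, and lasts for that many slots. -/
theorem Feasible.sum_sum_remaining_le (hA : I.Feasible A) (t : ℕ) :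
    ∑ u ∈ range t, ∑ i, I.remaining A u i ≤ I.sqFlow A := by
  let g : ℕ → Fin n → ℕ := fun u i => if I.release i ≤ u then I.completion A i - u else 0
  calc _ ≤ ∑ u ∈ range t, ∑ i, g u i := by
        refine sum_le_sum fun u _ => ?_
        refine (hA.sum_remaining_le univ u (univ.sup (g u)) fun i _ hi => ?_).trans
          (Finset.sup_le fun i _ => single_le_sum (fun _ _ => Nat.zero_le _) (mem_univ i))
        have h1 : g u i ≤ univ.sup (g u) := le_sup (f := g u) (mem_univ i)
        have h2 : g u i = I.completion A i - u := if_pos hi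
        omega
    _ = ∑ i, ∑ u ∈ range t, g u i := sum_comm
    _ ≤ _ := by
        refine sum_le_sum fun i _ => ?_
        calc ∑ u ∈ range t, g u i
            ≤ ∑ u ∈ range t, if u ∈ Ico (I.release i) (I.completion A i) then
                I.completion A i - I.release i else 0 := by
              refine sum_le_sum fun u _ => ?_
              simp only [g, mem_Ico]
              split_ifs <;> omega
          _ ≤ #(Ico (I.release i) (I.completion A i)) •
                (I.completion A i - I.release i) := by
              rw [← sum_filter, sum_const]
              refine Nat.mul_le_mul_right _ (card_le_card fun u hu => (mem_filter.1 hu).2)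
          _ = _ := by simp [sq]

theorem remaining_anti {s t : ℕ} {i : Fin n} (hi : I.release i ≤ s)
    (hst : s ≤ t) : I.remaining S t i ≤ I.remaining S s i := by
  have := S.executed_mono i hst
  simp only [remaining_eq, hi, hi.trans hst, if_true] at *
  omega

/-- The age of a job counts the earlier times at which it was present, each time with at least `z i`
remaining tasks. -/
theorem IsSRPT.sum_mul_le_sqFlow (hS : I.IsSRPT S) (hA : I.Feasible A) {t : ℕ} {z : Fin n → ℕ}
    (hz : ∀ i, z i ≤ I.remaining S t i) :
    ∑ i, (t - I.release i) * z i ≤ I.sqFlow A := by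
  calc ∑ i, (t - I.release i) * z i
      = ∑ i, ∑ u ∈ range t, if I.release i ≤ u then z i else 0 := by
        refine sum_congr rfl fun i _ => ?_
        rw [← sum_filter, sum_const, smul_eq_mul]
        congr 1
        rw [← Nat.card_Ico]
        congr 1
        ext u
        simp [and_comm]
    _ = ∑ u ∈ range t, ∑ i, if I.release i ≤ u then z i else 0 := sum_comm
    _ ≤ ∑ u ∈ range t, ∑ i, I.remaining S u i := by
        refine sum_le_sum fun u hu => sum_le_sum fun i _ => ?_
        split_ifs with h
        · exact (hz i).trans (remaining_anti h (mem_range.1 hu).le)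
        · exact Nat.zero_le _
    _ ≤ ∑ u ∈ range t, ∑ i, I.remaining A u i :=
        sum_le_sum fun u _ => hS.sum_remaining_le hA.valid u
    _ ≤ _ := hA.sum_sum_remaining_le t

theorem IsSRPT.mul_sq_le_sqFlow (hS : I.IsSRPT S) (hA : I.Feasible A) {t m Z : ℕ} (hZ : 0 < Z)
    (h : ∀ K : Finset (Fin n), #K ≤ m → Z ≤ 2 * ∑ i ∈ Kᶜ, I.remaining S t i) :
    (m + 1) * Z ^ 2 ≤ 4 * I.sqFlow A := by
  let K : Finset (Fin n) := {i | I.release i ≤ t ∧ Z ≤ 2 * (I.completion A i - t)}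
  have hK : m + 1 ≤ #K := by
    by_contra! hlt
    obtain ⟨K', hK', hsum⟩ := hS.exists_sum_remaining_le hA.valid t K
    have h1 := h K' (by omega)
    -- The largest integer below `Z / 2`: jobs outside `K` finish within this delay.
    have h2 := hA.sum_remaining_le Kᶜ t ((Z - 1) / 2) fun i hi hr => by
      have : ¬ (Z ≤ 2 * (I.completion A i - t)) := fun h' =>
        mem_compl.1 hi (mem_filter.2 ⟨mem_univ i, hr, h'⟩)
      omega
    omega
  calc (m + 1) * Z ^ 2 ≤ #K * Z ^ 2 := Nat.mul_le_mul_right _ hK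
    _ = ∑ i ∈ K, Z ^ 2 := by simp
    _ ≤ ∑ i ∈ K, (2 * (I.completion A i - I.release i)) ^ 2 := by
        refine sum_le_sum fun i hi => Nat.pow_le_pow_left ?_ 2
        simp only [K, mem_filter, mem_univ, true_and] at hi
        omega
    _ ≤ ∑ i, (2 * (I.completion A i - I.release i)) ^ 2 :=
        sum_le_sum_of_subset (subset_univ K)
    _ = _ := by
        simp only [sqFlow, mul_sum, mul_pow]
        norm_num

/-- Work that has waited under SRPT for `θ` times its volume forces every schedule to pay. -/
theorem IsSRPT.sqrt_mul_sq_le (hS : I.IsSRPT S) (hA : I.Feasible A) (hθ : 0 < θ) {t : ℕ}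
    {z : Fin n → ℕ} (hz : ∀ i, z i ≤ I.remaining S t i)
    (hw : ∀ i, θ * z i ≤ ((t - I.release i : ℕ) : ℝ)) :
    √θ * ((∑ i, z i : ℕ) : ℝ) ^ 2 ≤ 4 * I.F A := by
  rw [hA.F_eq]
  set Z := ∑ i, z i
  have hs : 0 < √θ := Real.sqrt_pos.2 hθ
  have hss : √θ * √θ = θ := Real.mul_self_sqrt hθ.le
  -- The two cases give bounds with factors `θ / m` and `m + 1`, balanced at `m ≈ √θ`.
  let m := ⌊√θ⌋₊
  obtain ⟨M, hM, hmax⟩ := exists_max_image {K : Finset (Fin n) | #K ≤ m} (fun K => ∑ i ∈ K, z i)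
    ⟨∅, by simp⟩
  simp only [mem_filter, mem_univ, true_and] at hM hmax
  by_cases hc : Z ≤ 2 * ∑ i ∈ M, z i
  · have h1 : θ * ∑ i, (z i : ℝ) ^ 2 ≤ I.sqFlow A := by
      have := hS.sum_mul_le_sqFlow hA hz
      calc θ * ∑ i, (z i : ℝ) ^ 2 ≤ ∑ i, ((t - I.release i : ℕ) : ℝ) * z i := by
            rw [mul_sum]
            refine sum_le_sum fun i _ => ?_
            rw [sq, ← mul_assoc]
            exact mul_le_mul_of_nonneg_right (hw i) (Nat.cast_nonneg _)
        _ ≤ _ := by exact_mod_cast this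
    have h2 : (∑ i ∈ M, (z i : ℝ)) ^ 2 ≤ √θ * ∑ i, (z i : ℝ) ^ 2 :=
      calc _ ≤ (#M : ℝ) * ∑ i ∈ M, (z i : ℝ) ^ 2 := sq_sum_le_card_mul_sum_sq
        _ ≤ √θ * ∑ i, (z i : ℝ) ^ 2 := by
          have : (#M : ℝ) ≤ √θ := (Nat.cast_le.2 hM).trans (Nat.floor_le hs.le)
          gcongr
          exact subset_univ M
    have h3 : (Z : ℝ) ^ 2 ≤ 4 * (∑ i ∈ M, (z i : ℝ)) ^ 2 := by
      have : (Z : ℝ) ≤ 2 * ∑ i ∈ M, (z i : ℝ) := by exact_mod_cast hc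
      calc (Z : ℝ) ^ 2 ≤ (2 * ∑ i ∈ M, (z i : ℝ)) ^ 2 := by gcongr
        _ = _ := by ring
    calc √θ * (Z : ℝ) ^ 2 ≤ √θ * (4 * (√θ * ∑ i, (z i : ℝ) ^ 2)) := by
          gcongr
          exact h3.trans (by linarith)
      _ = 4 * (√θ * √θ * ∑ i, (z i : ℝ) ^ 2) := by ring
      _ ≤ _ := by rw [hss]; linarith
  · have h1 := hS.mul_sq_le_sqFlow hA (t := t) (m := m) (Z := Z) (by omega) fun K hK => by
      have h2 := hmax K hK
      have h3 := sum_add_sum_compl K z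
      have h4 : ∑ i ∈ Kᶜ, z i ≤ ∑ i ∈ Kᶜ, I.remaining S t i := sum_le_sum fun i _ => hz i
      omega
    have h2 : ((m : ℝ) + 1) * (Z : ℝ) ^ 2 ≤ 4 * (I.sqFlow A : ℝ) := by exact_mod_cast h1
    refine le_trans ?_ h2
    gcongr
    exact (Nat.lt_floor_add_one _).le

/-! ### Decisions of BAL, and its feasibility. -/

theorem starving_congr {S' : Schedule n} {t s : ℕ} (h : ∀ u < t, S u = S' u) (hs : s ≤ t)
    (i : Fin n) : I.Starving θ S s i ↔ I.Starving θ S' s i := by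
  have he := Schedule.executed_congr (fun u hu => h u (hu.trans_le hs)) i
  simp only [Starving, Active, remaining_eq, he]

/-- The recursion for `bal` sees blank slots from `t` on; these could only alter starving times
beyond `t`. -/
theorem starvingTime_congr {S' : Schedule n} {t s : ℕ} {i : Fin n} (h : ∀ u < t, S u = S' u)
    (hs : s ≤ t) (hi : I.Starving θ S s i) : I.starvingTime θ S i = I.starvingTime θ S' i := by
  have key : ∀ {S S' : Schedule n}, (∀ u < t, S u = S' u) → I.Starving θ S s i →
      I.starvingTime θ S' i ≤ I.starvingTime θ S i := by
    intro S S' h hi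
    have h1 : I.Starving θ S (I.starvingTime θ S i) i :=
      Nat.sInf_mem (s := {t | I.Starving θ S t i}) ⟨s, hi⟩
    have h2 : I.starvingTime θ S i ≤ s := Nat.sInf_le hi
    exact Nat.sInf_le ((starving_congr h (h2.trans hs) i).1 h1)
  exact le_antisymm (key (fun u hu => (h u hu).symm) ((starving_congr h hs i).1 hi)) (key h hi)

theorem starving_starvingTime {s : ℕ} {i : Fin n} (h : I.Starving θ S s i) :
    I.Starving θ S (I.starvingTime θ S i) i :=
  Nat.sInf_mem (s := {t | I.Starving θ S t i}) ⟨s, h⟩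

theorem starvingTime_le {s : ℕ} {i : Fin n} (h : I.Starving θ S s i) :
    I.starvingTime θ S i ≤ s := Nat.sInf_le h

theorem mem_starvingSet {t : ℕ} {i : Fin n} :
    i ∈ I.starvingSet θ S t ↔ I.Active S t i ∧ ∃ s ≤ t, I.Starving θ S s i := by
  simp [starvingSet]

theorem starvingSet_congr {S' : Schedule n} {t : ℕ} (h : ∀ u < t, S u = S' u) :
    I.starvingSet θ S t = I.starvingSet θ S' t := by
  ext i
  have he := Schedule.executed_congr h i
  rw [mem_starvingSet, mem_starvingSet]
  refine and_congr (by simp only [Active, he]) (exists_congr fun s => and_congr_right fun hs => ?_)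
  exact starving_congr h hs i

/-- While jobs are starving, `BAL(θ)` processes one that became starving first. -/
theorem bal_of_starving {t : ℕ} (h : (I.starvingSet θ (I.bal θ σ) t).Nonempty) :
    ∃ j ∈ I.starvingSet θ (I.bal θ σ) t, I.bal θ σ t = some j ∧
      ∀ i ∈ I.starvingSet θ (I.bal θ σ) t,
        I.starvingTime θ (I.bal θ σ) j ≤ I.starvingTime θ (I.bal θ σ) i := by
  set B : Schedule n := I.bal θ σ with hB
  set B' : Schedule n := fun s => if s < t then B s else none
  have hc : ∀ u < t, B' u = B u := fun u hu => by simp [B', hu]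
  have hset : I.starvingSet θ B' t = I.starvingSet θ B t := starvingSet_congr hc
  have htime : ∀ i ∈ I.starvingSet θ B t, I.starvingTime θ B' i = I.starvingTime θ B i := by
    intro i hi
    rw [← hset] at hi
    obtain ⟨-, s, hs, hi⟩ := mem_starvingSet.1 hi
    exact starvingTime_congr hc hs hi
  have hbal : B t = I.balChoice θ σ B' t := by
    rw [hB, bal]
  have hne : (I.starvingSet θ B' t).Nonempty := hset ▸ h
  have hspec := Classical.choose_spec
    ((I.starvingSet θ B' t).exists_min_image (I.starvingKey θ B') hne)
  rw [balChoice, dif_pos hne] at hbal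
  refine ⟨_, hset ▸ hspec.1, hbal, fun i hi => ?_⟩
  have hle := hspec.2 i (hset ▸ hi)
  rw [← htime _ hi, ← htime _ (hset ▸ hspec.1)]
  exact (Prod.Lex.toLex_le_toLex.1 hle).elim le_of_lt fun h => h.1.le

theorem bal_of_not_starving {t : ℕ} (h : ¬ (I.starvingSet θ (I.bal θ σ) t).Nonempty) :
    (∀ i, I.bal θ σ t = some i → Schedule.executed (I.bal θ σ) t i < σ.executed (t + 1) i) ∧
      (I.bal θ σ t = none → ∀ i, σ.executed (t + 1) i ≤ Schedule.executed (I.bal θ σ) t i) := by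
  set B : Schedule n := I.bal θ σ with hB
  set B' : Schedule n := fun s => if s < t then B s else none
  have hc : ∀ u < t, B' u = B u := fun u hu => by simp [B', hu]
  have hset : I.starvingSet θ B' t = I.starvingSet θ B t := starvingSet_congr hc
  have hbal : B t = I.balChoice θ σ B' t := by
    rw [hB, bal]
  have hmem : ∀ i k, (i, k) ∈ backlog σ B' t ↔
      k < σ.executed (t + 1) i ∧ B.executed t i ≤ k := by
    intro i k
    rw [backlog, Set.mem_sdiff, Schedule.mem_tasksBefore, Schedule.mem_tasksBefore,
      Schedule.executed_congr hc, not_lt]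
  rw [balChoice, dif_neg (hset ▸ h)] at hbal
  by_cases hb : (backlog σ B' t).Nonempty
  · rw [dif_pos hb] at hbal
    refine ⟨fun i hi => ?_, fun hn => by simp [hn] at hbal⟩
    have h1 := Function.argminOn_mem σ.taskCompletion (backlog σ B' t) hb
    rw [hbal, Option.some.injEq] at hi
    generalize Function.argminOn σ.taskCompletion (backlog σ B' t) hb = a at h1 hi
    obtain ⟨h2, h3⟩ := (hmem a.1 a.2).1 h1
    rw [hi] at h2 h3
    omega
  · rw [dif_neg hb] at hbal
    refine ⟨fun i hi => by simp [hi] at hbal, fun _ i => ?_⟩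
    by_contra! hlt
    exact hb ⟨(i, B.executed t i), (hmem _ _).2 ⟨hlt, le_rfl⟩⟩

theorem bal_valid (hσ : I.Valid σ) : I.Valid (I.bal θ σ) := by
  intro t i hi
  by_cases h : (I.starvingSet θ (I.bal θ σ) t).Nonempty
  · obtain ⟨j, hj, hj', -⟩ := bal_of_starving h
    obtain rfl : i = j := Option.some.inj (hi.symm.trans hj')
    exact (mem_starvingSet.1 hj).1
  · have h1 := (bal_of_not_starving h).1 i hi
    have h2 := hσ.executed_le (t + 1) i
    refine ⟨?_, by omega⟩
    by_contra! hr
    have := hσ.executed_eq_zero (t := t + 1) (i := i) hr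
    omega

/-- BAL idles only with an empty backlog, when it has executed everything `σ` has. -/
theorem sum_executed_le_bal (t : ℕ) :
    ∑ i, σ.executed t i ≤ ∑ i, Schedule.executed (I.bal θ σ) t i := by
  induction t with
  | zero => simp [Schedule.executed_zero]
  | succ t ih =>
    have h1 := σ.sum_executed_add_le univ t 1
    rcases hj : I.bal θ σ t with _ | j
    · have hs : ¬ (I.starvingSet θ (I.bal θ σ) t).Nonempty := fun h => by
        obtain ⟨j, -, hj', -⟩ := bal_of_starving h
        simp [hj] at hj'
      refine sum_le_sum fun i _ => ((bal_of_not_starving hs).2 hj i).trans ?_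
      exact Schedule.executed_mono _ i (Nat.le_succ t)
    · simp only [Schedule.executed_succ (I.bal θ σ), sum_add_distrib]
      rw [Schedule.sum_indicator_eq_one hj (mem_univ j)]
      omega

theorem bal_feasible (hσ : I.IsSRPT σ) (hA : I.Feasible A) : I.Feasible (I.bal θ σ) := by
  refine ⟨bal_valid hσ.valid, fun i => ?_⟩
  let T := univ.sup (I.completion A)
  have hT : ∀ i, I.completion A i ≤ T := fun i => le_sup (f := I.completion A) (mem_univ i)
  have h1 := hσ.sum_remaining_le hA.valid T
  have h2 := hA.sum_remaining_le univ T 0 fun i _ _ => hT i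
  have h3 : ∀ i, I.proc i ≤ σ.executed T i := by
    intro i
    have h4 : ∑ i, I.remaining σ T i = 0 := by omega
    have h5 := sum_eq_zero_iff.1 h4 i (mem_univ i)
    rw [remaining_eq, if_pos ((hA.release_le_completion i).trans (hT i))] at h5
    omega
  have h6 : ∑ i, Schedule.executed (I.bal θ σ) T i = ∑ i, I.proc i :=
    le_antisymm (sum_le_sum fun i _ => (bal_valid hσ.valid).executed_le T i)
      ((sum_le_sum fun i _ => h3 i).trans (sum_executed_le_bal T))
  exact ⟨T, (sum_eq_sum_iff_of_le fun i _ => (bal_valid hσ.valid).executed_le T i).1 h6 i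
    (mem_univ i)⟩

/-! ### The pending starving volume. -/

open Classical in
/-- The number of tasks of job `i` that `S` executes before the job starves, for a job that
starves by time `t`; all tasks of the job otherwise. -/
noncomputable def normalWork (I : JobInstance n) (θ : ℝ) (S : Schedule n) (t : ℕ) (i : Fin n) :
    ℕ :=
  if ∃ s ≤ t, I.Starving θ S s i then S.executed (I.starvingTime θ S i) i else I.proc i

/-- In a normal slot BAL executes a task that `σ` has executed by the end of the slot; in a starving
slot the processed job is already past its normal work. -/
theorem min_normalWork_le {t s : ℕ} (hs : s ≤ t) (i : Fin n) :
    min (Schedule.executed (I.bal θ σ) s i) (I.normalWork θ (I.bal θ σ) t i) ≤ σ.executed s i := by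
  induction s with
  | zero => simp [Schedule.executed_zero]
  | succ s ih =>
    have ih := ih (by omega)
    have hmono := σ.executed_mono i (Nat.le_succ s)
    simp only [Nat.succ_eq_add_one] at hmono
    rw [Schedule.executed_succ]
    split_ifs with hi
    · by_cases h : (I.starvingSet θ (I.bal θ σ) s).Nonempty
      · obtain ⟨j, hj, hj', -⟩ := bal_of_starving h
        obtain rfl : i = j := Option.some.inj (hi.symm.trans hj')
        obtain ⟨-, u, hu, hst⟩ := mem_starvingSet.1 hj
        have h1 : I.normalWork θ (I.bal θ σ) t i
            = Schedule.executed (I.bal θ σ) (I.starvingTime θ (I.bal θ σ) i) i :=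
          if_pos ⟨u, by omega, hst⟩
        have h2 : Schedule.executed (I.bal θ σ) (I.starvingTime θ (I.bal θ σ) i) i
            ≤ Schedule.executed (I.bal θ σ) s i :=
          Schedule.executed_mono _ i ((starvingTime_le hst).trans hu)
        omega
      · have := (bal_of_not_starving h).1 i hi
        omega
    · omega

theorem sum_sub_max_le (hσ : I.Valid σ) (t : ℕ) :
    ∑ i, (I.proc i - max (I.normalWork θ (I.bal θ σ) t i) (Schedule.executed (I.bal θ σ) t i)) ≤
      ∑ i, (I.proc i - max (I.normalWork θ (I.bal θ σ) t i) (σ.executed t i)) := by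
  have hB := bal_valid (θ := θ) hσ
  have hw : ∀ i, I.normalWork θ (I.bal θ σ) t i ≤ I.proc i := by
    intro i
    unfold normalWork
    split_ifs
    · exact hB.executed_le _ i
    · exact le_rfl
  have h1 := sum_executed_le_bal (I := I) (θ := θ) (σ := σ) t
  -- Jobwise, by `x - max w x = min w x - w` over the integers.
  have h2 : ∑ i, (I.proc i - max (I.normalWork θ (I.bal θ σ) t i) (Schedule.executed (I.bal θ σ) t i))
        + ∑ i, Schedule.executed (I.bal θ σ) t i
      ≤ ∑ i, (I.proc i - max (I.normalWork θ (I.bal θ σ) t i) (σ.executed t i))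
        + ∑ i, σ.executed t i := by
    rw [← sum_add_distrib, ← sum_add_distrib]
    refine sum_le_sum fun i _ => ?_
    have := min_normalWork_le (I := I) (θ := θ) (σ := σ) (le_refl t) i
    have := hw i
    have := hB.executed_le t i
    have := hσ.executed_le t i
    omega
  omega

theorem sqrt_mul_sq_sum_le (hσ : I.IsSRPT σ) (hA : I.Feasible A) (hθ : 0 < θ) (t : ℕ) :
    √θ * ((∑ i, (I.proc i - max (I.normalWork θ (I.bal θ σ) t i)
      (Schedule.executed (I.bal θ σ) t i)) : ℕ) : ℝ) ^ 2 ≤ 4 * I.F A := by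
  refine le_trans ?_ (hσ.sqrt_mul_sq_le hA hθ (t := t)
    -- Jobs not starving by `t` contribute zero, their `normalWork` being all of `proc`.
    (z := fun i => I.proc i - max (I.normalWork θ (I.bal θ σ) t i) (σ.executed t i)) ?_ ?_)
  · have := sum_sub_max_le (θ := θ) hσ.valid t
    gcongr
  · intro i
    by_cases h : ∃ s ≤ t, I.Starving θ (I.bal θ σ) s i
    · obtain ⟨s, hs, h⟩ := h
      rw [remaining_eq, if_pos (h.1.1.trans hs)]
      omega
    · simp [normalWork, h]
  · intro i
    by_cases h : ∃ s ≤ t, I.Starving θ (I.bal θ σ) s i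
    · have ⟨s, hs, h'⟩ := h
      have hst := starving_starvingTime h'
      have hle := (starvingTime_le h').trans hs
      have hw : I.normalWork θ (I.bal θ σ) t i
          = Schedule.executed (I.bal θ σ) (I.starvingTime θ (I.bal θ σ) i) i := if_pos h
      obtain ⟨hact, hr⟩ := hst
      have hq : I.remaining (I.bal θ σ) (I.starvingTime θ (I.bal θ σ) i) i
          = I.proc i - I.normalWork θ (I.bal θ σ) t i := by
        rw [remaining_eq, if_pos hact.1, hw]
      have hpos : 0 < I.proc i - I.normalWork θ (I.bal θ σ) t i := by
        rw [hw]
        have := hact.2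
        omega
      rw [hq, le_div_iff₀ (by exact_mod_cast hpos)] at hr
      calc θ * ((I.proc i - max (I.normalWork θ (I.bal θ σ) t i) (σ.executed t i) : ℕ) : ℝ)
          ≤ θ * ((I.proc i - I.normalWork θ (I.bal θ σ) t i : ℕ) : ℝ) := by
            gcongr
            exact le_max_left _ _
        _ ≤ (t : ℝ) - I.release i := by
            refine hr.trans ?_
            gcongr
        _ = _ := by rw [Nat.cast_sub (hact.1.trans hle)]
    · simp [normalWork, h]

/-- Until `i` completes, the job processed became starving by `t`, so each slot consumes one task of
the volume fixed at `t`. -/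
theorem completion_sub_starvingTime_le (hσ : I.Valid σ) {i : Fin n} {s₀ : ℕ}
    (hi : I.Starving θ (I.bal θ σ) s₀ i) {t d : ℕ} (ht : t = I.starvingTime θ (I.bal θ σ) i)
    (hd : t + d ≤ I.completion (I.bal θ σ) i) :
    d + ∑ j, (I.proc j - max (I.normalWork θ (I.bal θ σ) t j) (Schedule.executed (I.bal θ σ) (t + d) j)) ≤
      ∑ j, (I.proc j - max (I.normalWork θ (I.bal θ σ) t j) (Schedule.executed (I.bal θ σ) t j)) := by
  have hst := starving_starvingTime hi
  induction d with
  | zero => simp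
  | succ d ih =>
    refine le_trans ?_ (ih (by omega))
    have hB := bal_valid (θ := θ) hσ
    have hact : I.Active (I.bal θ σ) (t + d) i := by
      refine ⟨by have := hst.1.1; omega, lt_of_le_of_ne (hB.executed_le _ i) fun h => ?_⟩
      have : I.completion (I.bal θ σ) i ≤ t + d := Nat.sInf_le h
      omega
    have hmem : i ∈ I.starvingSet θ (I.bal θ σ) (t + d) :=
      mem_starvingSet.2 ⟨hact, t, by omega, ht ▸ hst⟩
    obtain ⟨j, hj, hj', hmin⟩ := bal_of_starving ⟨i, hmem⟩
    have hji := hmin i hmem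
    obtain ⟨hjact, s, hs, hjs⟩ := mem_starvingSet.1 hj
    have hw : I.normalWork θ (I.bal θ σ) t j
        = Schedule.executed (I.bal θ σ) (I.starvingTime θ (I.bal θ σ) j) j :=
      if_pos ⟨_, ht ▸ hji, starving_starvingTime hjs⟩
    have hle : Schedule.executed (I.bal θ σ) (I.starvingTime θ (I.bal θ σ) j) j
        ≤ Schedule.executed (I.bal θ σ) (t + d) j :=
      Schedule.executed_mono _ j ((starvingTime_le hjs).trans hs)
    have hlt : ∑ j, (I.proc j - max (I.normalWork θ (I.bal θ σ) t j)
          (Schedule.executed (I.bal θ σ) (t + (d + 1)) j))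
        < ∑ j, (I.proc j - max (I.normalWork θ (I.bal θ σ) t j)
          (Schedule.executed (I.bal θ σ) (t + d) j)) := by
      refine sum_lt_sum (fun k _ => ?_) ⟨j, mem_univ j, ?_⟩
      · have := Schedule.executed_mono (I.bal θ σ) k (show t + d ≤ t + (d + 1) by omega)
        simp only at this
        omega
      · rw [← add_assoc, Schedule.executed_succ, if_pos hj']
        have := hjact.2
        omega
    omega

theorem sqrt_mul_starv_sq_le (hσ : I.IsSRPT σ) (hA : I.Feasible A) (hθ : 0 < θ) (i : Fin n) :
    √θ * I.starv θ σ i ^ 2 ≤ 4 * I.F A := by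
  by_cases h : ∃ s, I.Starving θ (I.bal θ σ) s i
  · obtain ⟨s, hs⟩ := h
    have hst := starving_starvingTime hs
    have hle : I.starvingTime θ (I.bal θ σ) i ≤ I.completion (I.bal θ σ) i := by
      by_contra! hlt
      have := (bal_feasible hσ hA (θ := θ)).executed_of_completion_le hlt.le
      have := hst.1.2
      omega
    obtain ⟨d, hd⟩ := Nat.exists_eq_add_of_le hle
    have h1 := completion_sub_starvingTime_le hσ.valid hs rfl hd.ge
    have h2 : I.starv θ σ i = d := by
      rw [starv, normalEnd, if_pos ⟨s, hs⟩, hd]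
      push_cast
      ring
    refine le_trans ?_ (sqrt_mul_sq_sum_le hσ hA hθ (I.starvingTime θ (I.bal θ σ) i))
    rw [h2]
    gcongr
    omega
  · have : I.starv θ σ i = 0 := by
      rw [starv, normalEnd, if_neg h, sub_self]
    have h0 : (0 : ℝ) ≤ I.sqFlow A := Nat.cast_nonneg _
    rw [this, hA.F_eq]
    linarith

end JobInstance

theorem mainTheorem3 :
    ∃ C : ℝ, 0 < C ∧
      ∀ (n : ℕ) (I : JobInstance n) (θ : ℝ), 0 < θ →
        ∀ SRPT OPT : Schedule n, I.IsSRPT SRPT → I.IsOptimal OPT →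
          I.Feasible (I.bal θ SRPT) ∧
            ∑ i, I.starv θ SRPT i ^ 2 ≤ C * ((n : ℝ) / √θ) * I.F OPT := by
  refine ⟨4, by norm_num, fun n I θ hθ SRPT OPT hS hO => ⟨JobInstance.bal_feasible hS hO.1, ?_⟩⟩
  have hs : 0 < √θ := Real.sqrt_pos.2 hθ
  calc ∑ i, I.starv θ SRPT i ^ 2 ≤ ∑ _i : Fin n, 4 * I.F OPT / √θ := by
        refine sum_le_sum fun i _ => ?_
        rw [le_div_iff₀ hs, mul_comm]
        exact JobInstance.sqrt_mul_starv_sq_le hS hO.1 hθ i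
    _ = 4 * ((n : ℝ) / √θ) * I.F OPT := by
        rw [sum_const, card_univ, Fintype.card_fin, nsmul_eq_mul]
        ring
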